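/- There is an absolute constant $C>0$ such that the following holds. Let $n,f,m\ge 1$ be integers with $m\vee f:=\max(m,f)\ge 2$. Let $A_0=(a_{ij})\in\mathbb{R}^{m\times m}$ and $B_0=(b_{ij})\in\mathbb{R}^{f\times f}$ be symmetric positive definite matrices whose stable ranks $r(M)=\|M\|_F^2/\|M\|_2^2$ (with $\|\cdot\|_F$ the Frobenius norm and $\|\cdot\|_2$ the operator norm) satisfy $$r(A_0)\ \ge\ \frac{4\log(m\vee f)}{n},\qquad r(B_0)\ \ge\ \frac{4\log(m\vee f)}{n}.$$ Let $X(1),\dots,X(n)$ be i.i.d. random $f\times m$ matrices with the matrix-normal law $\mathcal N_{f,m}(0,A_0\otimes B_0)$, that is, $\operatorname{vec}X(t)$ (the columns of $X(t)$ stacked) is a centred Gaussian vector with covariance matrix $A_0\otimes B_0$. Let $y(t)^1,\dots,y(t)^f\in\mathbb{R}^m$ be the rows and $x(t)^1,\dots,x(t)^m\in\mathbb{R}^f$ the columns of $X(t)$. Write $\rho_{ij}(A_0)=a_{ij}/\sqrt{a_{ii}a_{jj}}$, $\rho_{ij}(B_0)=b_{ij}/\sqrt{b_{ii}b_{jj}}$,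 $$K=\sup_{p\ge 1}p^{-1/2}\,(\mathbb E|\xi|^p)^{1/p}\ \text{ with } \xi\sim N(0,1),\qquad \tau_0=\frac{2CK^2\log^{1/2}(m\vee f)}{\sqrt n},$$ $$\alpha_n=\frac{\|A_0\|_F\,\tau_0}{\operatorname{tr}(A_0)},\qquad \beta_n=\frac{\|B_0\|_F\,\tau_0}{\operatorname{tr}(B_0)}.$$ Then, with probability at least $1-\dfrac{3}{(m\vee f)^2}$, the following inequalities hold simultaneously: $$\left|\frac{\frac1n\sum_{t=1}^n\langle y(t)^i,y(t)^j\rangle}{\operatorname{tr}(A_0)\sqrt{b_{ii}b_{jj}}}-\rho_{ij}(B_0)\right|\le\alpha_n\quad\text{for all }1\le i,j\le f,$$ $$\left|\frac{\frac1n\sum_{t=1}^n\langle x(t)^i,x(t)^j\rangle}{\operatorname{tr}(B_0)\sqrt{a_{ii}a_{jj}}}-\rho_{ij}(A_0)\right|\le\beta_n\quad\text{for all }1\le i,j\le m.$$ -/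

import Mathlib

open MeasureTheory ProbabilityTheory
open scoped Kronecker

noncomputable section

namespace Gemini

/-- The Frobenius norm `‖M‖_F`. -/
def frobNorm {ι : Type*} [Fintype ι] (M : Matrix ι ι ℝ) : ℝ :=
  Real.sqrt (∑ i, ∑ j, M i j ^ 2)

/-- The operator norm `‖M‖₂` of `M` acting on Euclidean space. -/
def opNorm {ι : Type*} [Fintype ι] [DecidableEq ι] (M : Matrix ι ι ℝ) : ℝ :=
  ‖Matrix.toEuclideanCLM (𝕜 := ℝ) M‖

/-- The stable rank `r(M) = ‖M‖_F² / ‖M‖₂²`. -/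
def stableRank {ι : Type*} [Fintype ι] [DecidableEq ι] (M : Matrix ι ι ℝ) : ℝ :=
  frobNorm M ^ 2 / opNorm M ^ 2

/-- The entries `ρ_ij(M) = m_ij / √(m_ii m_jj)` of the correlation matrix of `M`. -/
def corr {ι : Type*} (M : Matrix ι ι ℝ) (i j : ι) : ℝ :=
  M i j / Real.sqrt (M i i * M j j)

/-- The `ψ₂` norm `sup_{p ≥ 1} p^{-1/2} (E|ξ|^p)^{1/p}` of a real random variable `ξ`
(meaningful for sub-Gaussian `ξ`, where the supremum is finite). -/
def psi2Norm {Ω : Type*} [MeasurableSpace Ω] (ξ : Ω → ℝ) (μ : Measure Ω) : ℝ :=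
  sSup ((fun p : ℝ => p ^ (-(1 / 2) : ℝ) * (∫ ω, |ξ ω| ^ p ∂μ) ^ (1 / p)) '' Set.Ici 1)

/-- `K`, the `ψ₂` norm of a standard normal variable. -/
def gaussianPsi2 : ℝ := psi2Norm (fun x : ℝ => x) (gaussianReal 0 1)

/-- The matrix-normal law: `X ~ N_{f,m}(0, A ⊗ B)` means that `vec X`, which stacks the columns
of the `f × m` matrix `X`, is a centred Gaussian vector with covariance matrix `A ⊗ B`.
Coordinates of `vec X` are indexed by pairs (column, row). -/
def HasMatrixNormalLaw {Ω : Type*} [MeasurableSpace Ω] {f m : ℕ}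
    (X : Ω → Matrix (Fin f) (Fin m) ℝ)
    (A : Matrix (Fin m) (Fin m) ℝ) (B : Matrix (Fin f) (Fin f) ℝ) (μ : Measure Ω) : Prop :=
  HasLaw (fun ω => WithLp.toLp 2 (X ω).vec) (multivariateGaussian 0 (A ⊗ₖ B)) μ

/-- `X 1, …, X n` are independent with common law `N_{f,m}(0, A ⊗ B)`. -/
structure IsMatrixNormalSample {Ω : Type*} [MeasurableSpace Ω] {n f m : ℕ}
    (X : Fin n → Ω → Matrix (Fin f) (Fin m) ℝ)
    (A : Matrix (Fin m) (Fin m) ℝ) (B : Matrix (Fin f) (Fin f) ℝ) (μ : Measure Ω) : Prop where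
  law : ∀ t, HasMatrixNormalLaw (X t) A B μ
  indep : iIndepFun (fun t ω => WithLp.toLp 2 (X t ω).vec) μ

/-- The spectral assumption at given `n`, `f`, `m`: `A` and `B` are (symmetric) positive definite,
and their stable ranks are at least `4 log(m ∨ f) / n`. No quantitative bound on the
eigenvalues is imposed. -/
structure SpectralAssumption (n : ℕ) {f m : ℕ}
    (A : Matrix (Fin m) (Fin m) ℝ) (B : Matrix (Fin f) (Fin f) ℝ) : Prop where
  posDef_A : A.PosDef
  posDef_B : B.PosDef
  stableRank_A : 4 * Real.log (max m f : ℕ) / n ≤ stableRank A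
  stableRank_B : 4 * Real.log (max m f : ℕ) / n ≤ stableRank B

/-- `τ₀ = 2 C K² log^{1/2}(m ∨ f) / √n`. -/
def tau0 (C : ℝ) (n f m : ℕ) : ℝ :=
  2 * C * gaussianPsi2 ^ 2 * Real.sqrt (Real.log (max m f : ℕ)) / Real.sqrt n

/-- `α_n = ‖A‖_F τ₀ / tr A`. -/
def alpha (C : ℝ) (n f : ℕ) {m : ℕ} (A : Matrix (Fin m) (Fin m) ℝ) : ℝ :=
  frobNorm A * tau0 C n f m / A.trace

/-- `β_n = ‖B‖_F τ₀ / tr B`. -/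
def beta (C : ℝ) (n m : ℕ) {f : ℕ} (B : Matrix (Fin f) (Fin f) ℝ) : ℝ :=
  frobNorm B * tau0 C n f m / B.trace

/-- The event on which, simultaneously for all pairs of rows and all pairs of columns, the
normalized averaged inner products are within `α_n`, respectively `β_n`, of the correlations.
Row `i` of `X t ω` is the vector `y(t)^i`, column `i` is `x(t)^i`. -/
def largeDeviationEvent {Ω : Type*} (C : ℝ) {n f m : ℕ}
    (X : Fin n → Ω → Matrix (Fin f) (Fin m) ℝ)
    (A : Matrix (Fin m) (Fin m) ℝ) (B : Matrix (Fin f) (Fin f) ℝ) : Set Ω :=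
  {ω | (∀ i j : Fin f,
          |(1 / (n : ℝ)) * (∑ t, (X t ω).row i ⬝ᵥ (X t ω).row j) /
              (A.trace * Real.sqrt (B i i * B j j)) - corr B i j| ≤ alpha C n f A) ∧
       (∀ i j : Fin m,
          |(1 / (n : ℝ)) * (∑ t, (X t ω).col i ⬝ᵥ (X t ω).col j) /
              (B.trace * Real.sqrt (A i i * A j j)) - corr A i j| ≤ beta C n m B)}

end Gemini

end

namespace Gemini

open scoped NNReal

/-! A fixed combination `c` of the rows of `X(t)` is a centred Gaussian vector with covariance `v
A`, where `v = cᵀBc`. In an eigenbasis of `A` its squared length is a sum of independent squared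
Gaussians. Hence the centred squared length has mgf at most `exp(4 t² v² ‖A‖_F²)` as long as `|t| v
‖A‖₂ ≤ 1/4` (`mgf_normSq_sub_trace_le`).

Polarization writes the inner product of rows `i` and `j` through the combinations `y^i/√b_ii ±
y^j/√b_jj`, for which `v = 2 ± 2ρ_ij ≤ 4`. The Chernoff parameter that suits deviations of order
`‖A‖_F √(n log N)`, with `N = m ∨ f`, is admissible exactly because of the stable rank bound. Each
pair then fails with probability at most `4 N⁻⁶` (`measure_rowPair_le`), and a union bound over at
most `N²` pairs gives `N⁻²`. Columns follow by exchanging `A` and `B`. The constant `K` enters only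
through `K² ≥ 1/2`. -/

/-! ### Squares of one-dimensional Gaussians -/

lemma integral_exp_mul_sq_gaussianReal (v : ℝ≥0) {t : ℝ} (h : 2 * t * v < 1) :
    ∫ x, Real.exp (t * x ^ 2) ∂(gaussianReal 0 v) = (Real.sqrt (1 - 2 * t * v))⁻¹ := by
  rcases eq_or_ne v 0 with rfl | hv
  · simp
  have hv' : (0 : ℝ) < v := by positivity
  rw [integral_gaussianReal_eq_integral_smul hv]
  have hfun : ∀ x : ℝ, gaussianPDFReal 0 v x • Real.exp (t * x ^ 2) =
      (Real.sqrt (2 * Real.pi * v))⁻¹ * Real.exp (-((1 - 2 * t * v) / (2 * v)) * x ^ 2) := by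
    intro x
    rw [gaussianPDFReal, smul_eq_mul, mul_assoc, ← Real.exp_add]
    congr 2
    field_simp
    ring
  simp_rw [hfun]
  rw [integral_const_mul, integral_gaussian, ← Real.sqrt_inv, ← Real.sqrt_mul (by positivity),
    ← Real.sqrt_inv]
  congr 1
  have : 1 - 2 * t * (v : ℝ) ≠ 0 := by linarith
  field_simp

/-- Centring removes the linear term of `-log(1 - y)/2`; the remainder of the logarithm series is at
most `y²/(1 - |y|) ≤ 2y²`, halved by the square root. -/
lemma inv_sqrt_one_sub_mul_exp_le {y : ℝ} (hy : |y| ≤ 1 / 2) :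
    (Real.sqrt (1 - y))⁻¹ * Real.exp (-(y / 2)) ≤ Real.exp (y ^ 2) := by
  have hpos : 0 < 1 - y := by linarith [(abs_le.1 hy).2]
  have h := Real.abs_log_sub_add_sum_range_le (x := y) (by linarith) 1
  have h2 : |y| ^ 2 / (1 - |y|) ≤ 2 * y ^ 2 := by
    rw [div_le_iff₀ (by linarith), sq_abs]
    nlinarith [sq_nonneg y]
  have h3 := (abs_le.1 h).1
  simp only [Finset.range_one, Finset.sum_singleton, zero_add, pow_one, Nat.cast_zero, div_one,
    one_add_one_eq_two] at h3
  have h4 : (Real.sqrt (1 - y))⁻¹ = Real.exp (-(Real.log (1 - y) / 2)) := by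
    rw [Real.exp_neg, Real.exp_half, Real.exp_log hpos]
  rw [h4, ← Real.exp_add]
  apply Real.exp_le_exp.2
  linarith

/-- The moment generating function of a centred squared Gaussian variable is sub-exponential. -/
lemma mgf_sq_sub_variance_le {Ω : Type*} [MeasurableSpace Ω] {μ : Measure Ω} {W : Ω → ℝ}
    (hW : HasGaussianLaw W μ) (h0 : μ[W] = 0) {t : ℝ} (ht : |t| * Var[W; μ] ≤ 1 / 4) :
    0 < mgf (fun ω => W ω ^ 2 - Var[W; μ]) μ t ∧
      mgf (fun ω => W ω ^ 2 - Var[W; μ]) μ t ≤ Real.exp (4 * t ^ 2 * Var[W; μ] ^ 2) := by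
  set v := Var[W; μ] with hv
  have hv0 : 0 ≤ v := variance_nonneg _ _
  have hlaw := hW.map_eq_gaussianReal
  rw [h0, ← hv] at hlaw
  have habs : |2 * t * v| ≤ 1 / 2 := by
    rw [abs_mul, abs_mul, abs_of_nonneg hv0, abs_two]; linarith
  have hlt : 2 * t * v < 1 := by linarith [(abs_le.1 habs).2]
  have key : mgf (fun ω => W ω ^ 2 - v) μ t =
      (Real.sqrt (1 - 2 * t * v))⁻¹ * Real.exp (-((2 * t * v) / 2)) := by
    have hI := integral_exp_mul_sq_gaussianReal v.toNNReal (t := t)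
      (by rwa [Real.coe_toNNReal _ hv0])
    rw [Real.coe_toNNReal _ hv0, ← hlaw, integral_map hW.aemeasurable (by fun_prop)] at hI
    rw [mgf, ← hI, ← integral_mul_const]
    congr 1 with ω
    simp only [← Real.exp_add]
    congr 1
    ring
  rw [key]
  refine ⟨mul_pos (inv_pos.2 (Real.sqrt_pos.2 (by linarith))) (Real.exp_pos _), ?_⟩
  refine (inv_sqrt_one_sub_mul_exp_le habs).trans (le_of_eq ?_)
  congr 1
  ring

/-! ### Lower bound for the constant `K` -/

lemma abs_rpow_le_mul_exp {p : ℝ} (hp : 0 < p) (x : ℝ) :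
    |x| ^ p ≤ (2 * p) ^ (p / 2) * Real.exp (1 / 4 * x ^ 2) := by
  have h1 : |x| ^ p = (2 * p) ^ (p / 2) * (x ^ 2 / (2 * p)) ^ (p / 2) := by
    rw [← Real.mul_rpow (by positivity) (by positivity), mul_div_cancel₀ _ (by positivity),
      ← sq_abs, ← Real.rpow_natCast_mul (abs_nonneg x)]
    congr 1
    push_cast
    ring
  rw [h1]
  gcongr
  -- This is `u ≤ exp u` at `u = x²/(2p)`, chosen so that the power `p/2` leaves `x²/4` for every
  -- `p`.
  calc (x ^ 2 / (2 * p)) ^ (p / 2) ≤ Real.exp (x ^ 2 / (2 * p)) ^ (p / 2) := by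
        gcongr
        linarith [Real.add_one_le_exp (x ^ 2 / (2 * p))]
    _ = Real.exp (1 / 4 * x ^ 2) := by
        rw [← Real.exp_mul]
        congr 1
        field_simp
        ring

/-- Needed because `sSup` of an unbounded set of reals is `0`, which would make a lower bound on `K`
from a single moment invalid. -/
lemma bddAbove_gaussian_moments :
    BddAbove ((fun p : ℝ => p ^ (-(1 / 2) : ℝ) *
      (∫ x, |x| ^ p ∂(gaussianReal 0 1)) ^ (1 / p)) '' Set.Ici 1) := by
  refine ⟨Real.sqrt 2 * Real.sqrt 2, ?_⟩
  rintro _ ⟨p, hp, rfl⟩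
  have hp1 : (1 : ℝ) ≤ p := hp
  have hp0 : 0 < p := by linarith
  have hsqrt2 : (1 : ℝ) ≤ Real.sqrt 2 := Real.one_le_sqrt.2 (by norm_num)
  have hI : ∫ x, Real.exp (1 / 4 * x ^ 2) ∂(gaussianReal 0 1) = Real.sqrt 2 := by
    rw [integral_exp_mul_sq_gaussianReal 1 (by norm_num), ← Real.sqrt_inv]
    norm_num
  -- A nonzero integral forces integrability, since the default value is `0`.
  have hint : Integrable (fun x : ℝ => Real.exp (1 / 4 * x ^ 2)) (gaussianReal 0 1) := by
    by_contra hc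
    rw [integral_undef hc] at hI
    linarith
  have hM : ∫ x, |x| ^ p ∂(gaussianReal 0 1) ≤ (2 * p) ^ (p / 2) * Real.sqrt 2 := by
    rw [← hI, ← integral_const_mul]
    exact integral_mono_of_nonneg (ae_of_all _ fun x => by positivity) (hint.const_mul _)
      (ae_of_all _ fun x => abs_rpow_le_mul_exp hp0 x)
  have hM0 : 0 ≤ ∫ x, |x| ^ p ∂(gaussianReal 0 1) := integral_nonneg fun x => by positivity
  calc p ^ (-(1 / 2) : ℝ) * (∫ x, |x| ^ p ∂(gaussianReal 0 1)) ^ (1 / p)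
      ≤ p ^ (-(1 / 2) : ℝ) * ((2 * p) ^ (p / 2) * Real.sqrt 2) ^ (1 / p) := by gcongr
    _ = p ^ (-(1 / 2) : ℝ) * ((2 * p) ^ (1 / 2 : ℝ) * Real.sqrt 2 ^ (1 / p)) := by
        rw [Real.mul_rpow (by positivity) (by positivity), ← Real.rpow_mul (by positivity)]
        congr 3
        field_simp
    _ = Real.sqrt 2 * Real.sqrt 2 ^ (1 / p) := by
        rw [Real.mul_rpow (by positivity) hp0.le, Real.rpow_neg hp0.le, Real.sqrt_eq_rpow 2]
        have : p ^ (1 / 2 : ℝ) ≠ 0 := by positivity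
        field_simp
    _ ≤ Real.sqrt 2 * Real.sqrt 2 := by
        gcongr
        calc Real.sqrt 2 ^ (1 / p) ≤ Real.sqrt 2 ^ (1 : ℝ) :=
              Real.rpow_le_rpow_of_exponent_le hsqrt2 (by rw [div_le_one hp0]; exact hp1)
          _ = _ := Real.rpow_one _

lemma half_le_gaussianPsi2_sq : 1 / 2 ≤ gaussianPsi2 ^ 2 := by
  have h2 : (2 : ℝ) ^ (-(1 / 2) : ℝ) * (∫ x, |x| ^ (2 : ℝ) ∂(gaussianReal 0 1)) ^ (1 / (2 : ℝ)) ≤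
      gaussianPsi2 :=
    le_csSup bddAbove_gaussian_moments ⟨2, by norm_num, rfl⟩
  have hvar : ∫ x, |x| ^ (2 : ℝ) ∂(gaussianReal 0 1) = 1 := by
    have h := variance_id_gaussianReal (μ := 0) (v := 1)
    rw [variance_of_integral_eq_zero aemeasurable_id (by simp)] at h
    simpa using h
  rw [hvar, Real.one_rpow, mul_one, Real.rpow_neg (by norm_num), ← Real.sqrt_eq_rpow] at h2
  calc (1 / 2 : ℝ) = ((Real.sqrt 2)⁻¹) ^ 2 := by rw [inv_pow, Real.sq_sqrt (by norm_num)]; norm_num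
    _ ≤ gaussianPsi2 ^ 2 := by gcongr

/-! ### Matrix norms and diagonalization -/

open scoped Matrix

variable {ι κ : Type*} [Fintype ι] [Fintype κ]

lemma frobNorm_nonneg (M : Matrix κ κ ℝ) : 0 ≤ frobNorm M := Real.sqrt_nonneg _

lemma frobNorm_sq (M : Matrix κ κ ℝ) : frobNorm M ^ 2 = (Mᵀ * M).trace := by
  rw [frobNorm, Real.sq_sqrt (by positivity), Matrix.trace, Finset.sum_comm]
  simp [Matrix.mul_apply, sq]

lemma opNorm_nonneg [DecidableEq κ] (M : Matrix κ κ ℝ) : 0 ≤ opNorm M := norm_nonneg _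

lemma exists_orthogonal_diagonalization [DecidableEq κ] {A : Matrix κ κ ℝ} (hA : A.IsHermitian) :
    ∃ (U : Matrix κ κ ℝ) (d : κ → ℝ), U * Uᵀ = 1 ∧ Uᵀ * A * U = Matrix.diagonal d ∧
      (∀ k, |d k| ≤ opNorm A) ∧ ∑ k, d k = A.trace ∧ ∑ k, d k ^ 2 = frobNorm A ^ 2 := by
  set U : Matrix κ κ ℝ := hA.eigenvectorUnitary.1 with hU
  have hstar : star U = Uᵀ := by
    rw [Matrix.star_eq_conjTranspose, Matrix.conjTranspose_eq_transpose_of_trivial]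
  have h1 : U * Uᵀ = 1 := by rw [← hstar]; exact Unitary.coe_mul_star_self _
  have h2 : Uᵀ * A * U = Matrix.diagonal hA.eigenvalues := by
    have h := hA.conjStarAlgAut_star_eigenvectorUnitary
    rw [Unitary.conjStarAlgAut_apply] at h
    simpa [← hU, ← hstar] using h
  have hAT : Aᵀ = A := by
    rw [← Matrix.conjTranspose_eq_transpose_of_trivial]; exact hA
  refine ⟨U, hA.eigenvalues, h1, h2, fun k => ?_, ?_, ?_⟩
  · have h := (Matrix.toEuclideanCLM (𝕜 := ℝ) A).le_opNorm (hA.eigenvectorBasis k)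
    have he : Matrix.toEuclideanCLM (𝕜 := ℝ) A (hA.eigenvectorBasis k) =
        hA.eigenvalues k • hA.eigenvectorBasis k := by
      ext j
      rw [Matrix.ofLp_toEuclideanCLM, hA.mulVec_eigenvectorBasis]
      rfl
    rw [he, norm_smul, hA.eigenvectorBasis.norm_eq_one, mul_one, mul_one] at h
    exact h
  · have h := congrArg Matrix.trace h2
    rw [Matrix.trace_mul_comm, ← Matrix.mul_assoc, h1, Matrix.one_mul, Matrix.trace_diagonal] at h
    exact h.symm
  · have h : (Uᵀ * A * U) * (Uᵀ * A * U) = Uᵀ * (A * A) * U := by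
      calc (Uᵀ * A * U) * (Uᵀ * A * U) = Uᵀ * A * (U * Uᵀ) * A * U := by
            simp only [Matrix.mul_assoc]
        _ = Uᵀ * (A * A) * U := by rw [h1, Matrix.mul_one]; simp only [Matrix.mul_assoc]
    rw [h2, Matrix.diagonal_mul_diagonal] at h
    have h' := congrArg Matrix.trace h
    rw [Matrix.trace_mul_comm, ← Matrix.mul_assoc, h1, Matrix.one_mul, Matrix.trace_diagonal] at h'
    rw [frobNorm_sq, hAT, ← h']
    simp [sq]

/-! ### Concentration of the squared length of Gaussian vectors -/

section Vector

variable {Ω : Type*} [MeasurableSpace Ω] {μ : Measure Ω}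

lemma hasGaussianLaw_mulVec {Y : Ω → ι → ℝ} (hY : HasGaussianLaw Y μ)
    (L : Matrix κ ι ℝ) : HasGaussianLaw (fun ω => L *ᵥ Y ω) μ :=
  hY.map_fun (LinearMap.toContinuousLinearMap L.mulVecLin)

lemma covariance_dotProduct {Y : Ω → ι → ℝ} (hY : HasGaussianLaw Y μ)
    (a b : ι → ℝ) :
    cov[fun ω => a ⬝ᵥ Y ω, fun ω => b ⬝ᵥ Y ω; μ] =
      ∑ i, ∑ j, a i * b j * cov[fun ω => Y ω i, fun ω => Y ω j; μ] := by
  have := hY.isProbabilityMeasure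
  have hL (i : ι) : MemLp (fun ω => Y ω i) 2 μ := (HasGaussianLaw.eval hY i).memLp_two
  simp only [dotProduct]
  rw [covariance_fun_sum_fun_sum (fun i => (hL i).const_mul _) (fun i => (hL i).const_mul _)]
  simp_rw [covariance_const_mul_left, covariance_const_mul_right, mul_assoc]

lemma integral_dotProduct_eq_zero {Y : Ω → ι → ℝ} (hY : HasGaussianLaw Y μ)
    (h0 : ∀ i, ∫ ω, Y ω i ∂μ = 0) (a : ι → ℝ) : ∫ ω, a ⬝ᵥ Y ω ∂μ = 0 := by
  simp only [dotProduct]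
  rw [integral_finsetSum _ fun i _ => ((HasGaussianLaw.eval hY i).integrable.const_mul _)]
  simp [integral_const_mul, h0]

/-- Eigenbasis coordinates are jointly Gaussian and uncorrelated, hence independent, so the mgf
factors; `∑ d_k² = ‖A‖_F²` collects the exponents. -/
lemma mgf_normSq_sub_trace_le [DecidableEq κ] {Y : Ω → κ → ℝ} (hY : HasGaussianLaw Y μ)
    (h0 : ∀ i, ∫ ω, Y ω i ∂μ = 0) {A : Matrix κ κ ℝ} (hA : A.PosSemidef) {v : ℝ} (hv : 0 ≤ v)
    (hcov : ∀ i j, cov[fun ω => Y ω i, fun ω => Y ω j; μ] = v * A i j)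
    {t : ℝ} (ht : |t| * (v * opNorm A) ≤ 1 / 4) :
    0 < mgf (fun ω => Y ω ⬝ᵥ Y ω - v * A.trace) μ t ∧
      mgf (fun ω => Y ω ⬝ᵥ Y ω - v * A.trace) μ t ≤
        Real.exp (4 * t ^ 2 * v ^ 2 * frobNorm A ^ 2) := by
  obtain ⟨U, d, hU, hD, hle, htr, hfr⟩ := exists_orthogonal_diagonalization hA.isHermitian
  let W : κ → Ω → ℝ := fun k ω => (Uᵀ *ᵥ Y ω) k
  have hW : HasGaussianLaw (fun ω => (W · ω)) μ := hasGaussianLaw_mulVec hY Uᵀ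
  have hWcov : ∀ k l, cov[W k, W l; μ] = v * Matrix.diagonal d k l := by
    intro k l
    have h := covariance_dotProduct hY (Uᵀ k) (Uᵀ l)
    refine h.trans ?_
    simp_rw [hcov]
    rw [← hD, Matrix.mul_apply, Finset.mul_sum, Finset.sum_comm]
    simp_rw [Matrix.mul_apply, Finset.sum_mul, Finset.mul_sum]
    refine Finset.sum_congr rfl fun i _ => Finset.sum_congr rfl fun j _ => ?_
    simp only [Matrix.transpose_apply]
    ring
  have hind : iIndepFun W μ := hW.iIndepFun_of_covariance_eq_zero fun k l hkl => by
    rw [hWcov, Matrix.diagonal_apply_ne _ hkl, mul_zero]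
  have hWmeas (k : κ) : AEMeasurable (W k) μ := (HasGaussianLaw.eval hW k).aemeasurable
  have hvar (k : κ) : Var[W k; μ] = v * d k := by
    rw [← covariance_self (hWmeas k), hWcov, Matrix.diagonal_apply_eq]
  have hsum : (fun ω => Y ω ⬝ᵥ Y ω - v * A.trace) =
      ∑ k, fun ω => W k ω ^ 2 - v * d k := by
    ext ω
    rw [Finset.sum_apply, Finset.sum_sub_distrib, ← Finset.mul_sum, htr]
    congr 1
    calc Y ω ⬝ᵥ Y ω = (Uᵀ *ᵥ Y ω) ⬝ᵥ (Uᵀ *ᵥ Y ω) := by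
          rw [Matrix.dotProduct_mulVec, Matrix.vecMul_transpose, Matrix.mulVec_mulVec, hU,
            Matrix.one_mulVec]
      _ = ∑ k, W k ω ^ 2 := by simp [dotProduct, W, sq]
  have hone (k : κ) := mgf_sq_sub_variance_le (HasGaussianLaw.eval hW k)
    (integral_dotProduct_eq_zero hY h0 (Uᵀ k)) (t := t) (by
      refine le_trans ?_ ht
      rw [hvar]
      gcongr
      exact (le_abs_self _).trans (hle k))
  simp only [hvar] at hone
  have hind' : iIndepFun (fun k ω => W k ω ^ 2 - v * d k) μ :=
    hind.comp (fun k x => x ^ 2 - v * d k) (fun k => by fun_prop)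
  rw [hsum, hind'.mgf_sum₀ (fun k => by have := hWmeas k; fun_prop)]
  refine ⟨Finset.prod_pos fun k _ => (hone k).1, ?_⟩
  calc ∏ k, mgf (fun ω => W k ω ^ 2 - v * d k) μ t
      ≤ ∏ k, Real.exp (4 * t ^ 2 * (v * d k) ^ 2) :=
        Finset.prod_le_prod (fun k _ => (hone k).1.le) fun k _ => (hone k).2
    _ = Real.exp (4 * t ^ 2 * v ^ 2 * frobNorm A ^ 2) := by
        rw [← Real.exp_sum, ← hfr, Finset.mul_sum]
        congr 1
        refine Finset.sum_congr rfl fun k _ => ?_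
        ring

/-- Two-sided tail bound for the total squared length of an independent sample of centred Gaussian
vectors with covariance matrix `v A`. -/
lemma measure_abs_sum_normSq_sub_trace_ge_le [DecidableEq κ] {n : ℕ} {Y : Fin n → Ω → κ → ℝ}
    (hY : ∀ t, HasGaussianLaw (Y t) μ) (hind : iIndepFun Y μ)
    (h0 : ∀ t i, ∫ ω, Y t ω i ∂μ = 0) {A : Matrix κ κ ℝ} (hA : A.PosSemidef) {v : ℝ}
    (hv : 0 ≤ v) (hcov : ∀ t i j, cov[fun ω => Y t ω i, fun ω => Y t ω j; μ] = v * A i j)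
    {a : ℝ} (ha : 0 ≤ a) (hav : a * (v * opNorm A) ≤ 1 / 4) (s : ℝ) :
    μ.real {ω | s ≤ |∑ t, (Y t ω ⬝ᵥ Y t ω - v * A.trace)|} ≤
      2 * Real.exp (-a * s + n * (4 * a ^ 2 * v ^ 2 * frobNorm A ^ 2)) := by
  have := hind.isProbabilityMeasure
  set T : Ω → ℝ := ∑ t, fun ω => Y t ω ⬝ᵥ Y t ω - v * A.trace with hT
  have hmeas : Measurable fun y : κ → ℝ => y ⬝ᵥ y - v * A.trace := by
    simp only [dotProduct]; fun_prop
  have hind' : iIndepFun (fun t ω => Y t ω ⬝ᵥ Y t ω - v * A.trace) μ :=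
    hind.comp (fun _ y => y ⬝ᵥ y - v * A.trace) fun _ => hmeas
  have hmgf (b : ℝ) (hb : |b| = a) : 0 < mgf T μ b ∧
      mgf T μ b ≤ Real.exp (n * (4 * a ^ 2 * v ^ 2 * frobNorm A ^ 2)) := by
    have hone (t : Fin n) := mgf_normSq_sub_trace_le (hY t) (h0 t) hA hv (hcov t) (t := b)
      (by rwa [hb])
    rw [hT, hind'.mgf_sum₀ fun t => hmeas.comp_aemeasurable (hY t).aemeasurable]
    refine ⟨Finset.prod_pos fun t _ => (hone t).1, ?_⟩
    refine (Finset.prod_le_prod (fun t _ => (hone t).1.le) fun t _ => (hone t).2).trans ?_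
    rw [Finset.prod_const, Finset.card_univ, Fintype.card_fin, ← Real.exp_nat_mul, ← hb, sq_abs]
  have hset : {ω | s ≤ |∑ t, (Y t ω ⬝ᵥ Y t ω - v * A.trace)|} ⊆
      {ω | s ≤ T ω} ∪ {ω | T ω ≤ -s} := by
    intro ω hω
    have hω' : s ≤ |T ω| := by simpa [hT] using hω
    rcases le_abs.1 hω' with h | h
    · exact Or.inl h
    · exact Or.inr (show T ω ≤ -s by linarith)
  have hup := hmgf a (abs_of_nonneg ha)
  have hlo := hmgf (-a) (by rw [abs_neg, abs_of_nonneg ha])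
  -- Positivity of the mgf is carried along because it encodes integrability of the exponential.
  have h1 := measure_ge_le_exp_mul_mgf (μ := μ) (X := T) s ha (mgf_pos_iff.1 hup.1)
  have h2 := measure_le_le_exp_mul_mgf (μ := μ) (X := T) (-s) (neg_nonpos.2 ha)
    (mgf_pos_iff.1 hlo.1)
  rw [neg_mul_neg] at h2
  rw [Real.exp_add]
  calc _ ≤ μ.real {ω | s ≤ T ω} + μ.real {ω | T ω ≤ -s} :=
        (measureReal_mono hset).trans (measureReal_union_le _ _)
    _ ≤ Real.exp (-a * s) * Real.exp (n * (4 * a ^ 2 * v ^ 2 * frobNorm A ^ 2)) +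
        Real.exp (-a * s) * Real.exp (n * (4 * a ^ 2 * v ^ 2 * frobNorm A ^ 2)) := by
        gcongr
        · exact h1.trans (by gcongr; exact hup.2)
        · refine h2.trans ?_
          gcongr
          exact hlo.2
    _ = _ := by ring

end Vector

/-! ### Row correlations of matrix-normal samples -/

section Sample

variable {Ω : Type*} [MeasurableSpace Ω] {μ : Measure Ω}

/-- `V 1, …, V n` are independent centred Gaussian arrays in which the entries `p` and `q` have
covariance `B p.1 q.1 * A p.2 q.2`. -/
structure IsGaussianArraySample {n : ℕ} (V : Fin n → Ω → ι × κ → ℝ) (A : Matrix κ κ ℝ)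
    (B : Matrix ι ι ℝ) (μ : Measure Ω) : Prop where
  gaussian : ∀ t, HasGaussianLaw (V t) μ
  mean : ∀ t p, ∫ ω, V t ω p ∂μ = 0
  cov : ∀ t p q, cov[fun ω => V t ω p, fun ω => V t ω q; μ] = B p.1 q.1 * A p.2 q.2
  indep : iIndepFun V μ

lemma IsGaussianArraySample.swap {n : ℕ} {V : Fin n → Ω → ι × κ → ℝ} {A : Matrix κ κ ℝ}
    {B : Matrix ι ι ℝ} (hV : IsGaussianArraySample V A B μ) :
    IsGaussianArraySample (fun t ω (p : κ × ι) => V t ω p.swap) B A μ where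
  gaussian t := (hV.gaussian t).map_fun
    (ContinuousLinearMap.pi fun p : κ × ι => ContinuousLinearMap.proj p.swap)
  mean t p := hV.mean t p.swap
  cov t p q := (hV.cov t p.swap q.swap).trans (mul_comm _ _)
  indep := hV.indep.comp (fun _ x (p : κ × ι) => x p.swap) fun _ => by fun_prop

lemma IsMatrixNormalSample.isGaussianArraySample {n f m : ℕ}
    {X : Fin n → Ω → Matrix (Fin f) (Fin m) ℝ} {A : Matrix (Fin m) (Fin m) ℝ}
    {B : Matrix (Fin f) (Fin f) ℝ} (hX : IsMatrixNormalSample X A B μ) (hA : A.PosSemidef)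
    (hB : B.PosSemidef) :
    IsGaussianArraySample (fun t ω (p : Fin f × Fin m) => X t ω p.1 p.2) A B μ where
  gaussian t := (hX.law t).hasGaussianLaw.map_fun (ContinuousLinearMap.pi
    fun p : Fin f × Fin m => EuclideanSpace.proj (p.2, p.1))
  mean t p := by
    have h := (hX.law t).integral_comp
      (f := fun x : EuclideanSpace ℝ (Fin m × Fin f) => EuclideanSpace.proj (𝕜 := ℝ) (p.2, p.1) x)
      (by fun_prop)
    rw [ContinuousLinearMap.integral_comp_comm _ IsGaussian.integrable_fun_id,
      integral_id_multivariateGaussian, map_zero] at h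
    exact h
  cov t p q := by
    have h := (hX.law t).covariance_fun_comp
      (f := fun x : EuclideanSpace ℝ (Fin m × Fin f) => x (p.2, p.1))
      (g := fun x : EuclideanSpace ℝ (Fin m × Fin f) => x (q.2, q.1))
      (by fun_prop) (by fun_prop)
    rw [covariance_eval_multivariateGaussian (hA.kronecker hB)] at h
    exact h.trans (mul_comm _ _)
  indep := hX.indep.comp (fun _ x (p : Fin f × Fin m) => x (p.2, p.1)) fun _ => by fun_prop

/-- Tail bound for the total squared length of a fixed linear combination of the rows. -/
lemma IsGaussianArraySample.measure_rowCombination_le [DecidableEq κ] {n : ℕ}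
    {V : Fin n → Ω → ι × κ → ℝ} {A : Matrix κ κ ℝ} {B : Matrix ι ι ℝ}
    (hV : IsGaussianArraySample V A B μ) (hA : A.PosSemidef) (c : ι → ℝ)
    (hc : 0 ≤ c ⬝ᵥ B *ᵥ c) {a : ℝ} (ha : 0 ≤ a)
    (hav : a * ((c ⬝ᵥ B *ᵥ c) * opNorm A) ≤ 1 / 4) (s : ℝ) :
    μ.real {ω | s ≤ |∑ t, (∑ k, (∑ i, c i * V t ω (i, k)) ^ 2 - (c ⬝ᵥ B *ᵥ c) * A.trace)|} ≤
      2 * Real.exp (-a * s + n * (4 * a ^ 2 * (c ⬝ᵥ B *ᵥ c) ^ 2 * frobNorm A ^ 2)) := by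
  -- `M` is `cᵀ ⊗ I`, acting on the flattened array.
  let M : Matrix κ (ι × κ) ℝ := fun k p => if p.2 = k then c p.1 else 0
  have hM (x : ι × κ → ℝ) (k : κ) : M k ⬝ᵥ x = ∑ i, c i * x (i, k) := by
    simp [dotProduct, M, Fintype.sum_prod_type, ite_mul]
  have h := measure_abs_sum_normSq_sub_trace_ge_le (μ := μ) (Y := fun t ω => M *ᵥ V t ω)
    (fun t => hasGaussianLaw_mulVec (hV.gaussian t) M)
    (hV.indep.comp (fun _ x => M *ᵥ x) fun _ => by
      refine measurable_pi_lambda _ fun k => ?_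
      simp only [Matrix.mulVec, dotProduct]
      fun_prop)
    (fun t k => integral_dotProduct_eq_zero (hV.gaussian t) (hV.mean t) (M k)) hA hc
    (fun t k l => by
      refine (covariance_dotProduct (hV.gaussian t) (M k) (M l)).trans ?_
      simp_rw [hV.cov, Fintype.sum_prod_type]
      simp only [M, dotProduct, Matrix.mulVec, ite_mul, mul_ite, zero_mul, mul_zero,
        Finset.sum_ite_eq', Finset.mem_univ, if_true, Finset.sum_ite_irrel, Finset.sum_const_zero]
      rw [Finset.sum_mul]
      refine Finset.sum_congr rfl fun i _ => ?_
      rw [Finset.mul_sum, Finset.sum_mul]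
      refine Finset.sum_congr rfl fun j _ => ?_
      ring) ha hav s
  have hsq (t : Fin n) (ω : Ω) : (M *ᵥ V t ω) ⬝ᵥ (M *ᵥ V t ω) =
      ∑ k, (∑ i, c i * V t ω (i, k)) ^ 2 := by
    simp only [← hM, sq]
    rfl
  simpa only [hsq] using h

lemma four_mul_log_le_of_stableRank [DecidableEq κ] {A : Matrix κ κ ℝ} {n : ℕ} (hn : 1 ≤ n) {L : ℝ}
    (hL : 0 < L) (h : 4 * L / n ≤ stableRank A) :
    0 < frobNorm A ∧ 2 * Real.sqrt L * opNorm A ≤ Real.sqrt n * frobNorm A := by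
  have hn' : (0 : ℝ) < n := by exact_mod_cast hn
  have hpos : 0 < stableRank A := lt_of_lt_of_le (by positivity) h
  have hop : 0 < opNorm A := by
    refine (opNorm_nonneg A).lt_of_ne' fun h0 => ?_
    simp [stableRank, h0] at hpos
  have hfr : 0 < frobNorm A := by
    refine (frobNorm_nonneg A).lt_of_ne' fun h0 => ?_
    simp [stableRank, h0] at hpos
  refine ⟨hfr, ?_⟩
  rw [stableRank, div_le_div_iff₀ hn' (by positivity)] at h
  refine (sq_le_sq₀ (by positivity) (by positivity)).1 ?_
  rw [mul_pow, mul_pow, mul_pow, Real.sq_sqrt hL.le, Real.sq_sqrt hn'.le]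
  linarith

lemma IsGaussianArraySample.measure_rowPair_le [DecidableEq ι] [DecidableEq κ] {n : ℕ}
    {V : Fin n → Ω → ι × κ → ℝ} {A : Matrix κ κ ℝ} {B : Matrix ι ι ℝ}
    (hV : IsGaussianArraySample V A B μ) (hA : A.PosDef) (hB : B.PosDef) [Nonempty κ]
    (hn : 1 ≤ n) {L τ : ℝ} (hL : 0 < L) (hr : 4 * L / n ≤ stableRank A)
    (hτ : 28 * Real.sqrt L / Real.sqrt n ≤ τ) (i j : ι) :
    μ.real {ω | ¬ |(1 / (n : ℝ)) * (∑ t, ∑ k, V t ω (i, k) * V t ω (j, k)) /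
      (A.trace * Real.sqrt (B i i * B j j)) - corr B i j| ≤ frobNorm A * τ / A.trace} ≤
      4 * Real.exp (-6 * L) := by
  have := hV.indep.isProbabilityMeasure
  obtain ⟨hF, hop⟩ := four_mul_log_le_of_stableRank hn hL hr
  have hn' : (0 : ℝ) < n := by exact_mod_cast hn
  have htr : 0 < A.trace := hA.trace_pos
  have hbi : 0 < B i i := hB.diag_pos
  have hbj : 0 < B j j := hB.diag_pos
  have hsym : B j i = B i j := by simpa using hB.isHermitian.apply i j
  set p := Real.sqrt (B i i) with hp
  set q := Real.sqrt (B j j) with hq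
  have hp0 : 0 < p := Real.sqrt_pos.2 hbi
  have hq0 : 0 < q := Real.sqrt_pos.2 hbj
  have hpp : p * p = B i i := Real.mul_self_sqrt hbi.le
  have hqq : q * q = B j j := Real.mul_self_sqrt hbj.le
  have hpq : Real.sqrt (B i i * B j j) = p * q := Real.sqrt_mul hbi.le _
  have hcorr : corr B i j = B i j / (p * q) := by rw [corr, hpq]
  -- Used at `ε = ±1`: the difference of the two squares is four times the normalized product.
  let c : ℝ → ι → ℝ := fun ε => Pi.single i (1 / p) + Pi.single j (ε / q)
  have hcx (ε : ℝ) (x : ι → ℝ) : ∑ l, c ε l * x l = x i / p + ε * x j / q := by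
    simp only [c, Pi.add_apply, add_mul, Finset.sum_add_distrib]
    simp [Pi.single_apply, ite_mul]
    ring
  have hv (ε : ℝ) (hε : ε * ε = 1) : c ε ⬝ᵥ B *ᵥ c ε = 2 + 2 * ε * corr B i j := by
    have h1 (l : ι) : (B *ᵥ c ε) l = B l i / p + ε * B l j / q := by
      rw [Matrix.mulVec, dotProduct_comm]; exact hcx ε _
    rw [dotProduct, hcx, h1, h1, hsym, ← hpp, ← hqq, hcorr]
    field_simp
    linear_combination (p * q) * hε
  have hv0 (ε : ℝ) : 0 ≤ c ε ⬝ᵥ B *ᵥ c ε := by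
    simpa using hB.posSemidef.dotProduct_mulVec_nonneg (c ε)
  have hvp := hv 1 (by norm_num)
  have hvm := hv (-1) (by norm_num)
  have hvp0 := hv0 1
  have hvm0 := hv0 (-1)
  set S : ℝ := 2 * n * frobNorm A * τ with hS
  -- With `v ≤ 4`, the stable rank bound gives `a v ‖A‖₂ ≤ 1/4`; the exponent is at most `-7L + L`,
  -- the `7` coming from `28 · 2 / 8`.
  set a : ℝ := Real.sqrt L / (8 * (Real.sqrt n * frobNorm A)) with ha
  have hsn : 0 < Real.sqrt n := Real.sqrt_pos.2 hn'
  have hsL : 0 < Real.sqrt L := Real.sqrt_pos.2 hL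
  have ha0 : 0 ≤ a := by positivity
  let bad : ℝ → Set Ω := fun ε =>
    {ω | S ≤ |∑ t, (∑ k, (∑ l, c ε l * V t ω (l, k)) ^ 2 - (c ε ⬝ᵥ B *ᵥ c ε) * A.trace)|}
  have hbad (ε : ℝ) (h4 : c ε ⬝ᵥ B *ᵥ c ε ≤ 4) : μ.real (bad ε) ≤ 2 * Real.exp (-6 * L) := by
    refine (hV.measure_rowCombination_le hA.posSemidef (c ε) (hv0 ε) ha0 ?_ S).trans ?_
    · calc a * ((c ε ⬝ᵥ B *ᵥ c ε) * opNorm A) ≤ a * (4 * opNorm A) := by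
            gcongr
            exact opNorm_nonneg A
        _ = (2 * Real.sqrt L * opNorm A) / (4 * (Real.sqrt n * frobNorm A)) := by
            rw [ha]; field_simp; ring
        _ ≤ 1 / 4 := by
            rw [div_le_iff₀ (by positivity)]
            linarith
    · gcongr
      have h1 : 7 * L ≤ a * S := by
        calc 7 * L = a * (2 * n * frobNorm A * (28 * Real.sqrt L / Real.sqrt n)) := by
              rw [ha]
              field_simp
              rw [Real.sq_sqrt hL.le, Real.sq_sqrt hn'.le]
              ring
          _ ≤ a * S := by rw [hS]; gcongr
      have h2 : n * (4 * a ^ 2 * (c ε ⬝ᵥ B *ᵥ c ε) ^ 2 * frobNorm A ^ 2) ≤ L := by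
        calc n * (4 * a ^ 2 * (c ε ⬝ᵥ B *ᵥ c ε) ^ 2 * frobNorm A ^ 2)
            ≤ n * (4 * a ^ 2 * 4 ^ 2 * frobNorm A ^ 2) := by
              have := hv0 ε
              gcongr
          _ = L := by
              rw [ha, div_pow, mul_pow, mul_pow, Real.sq_sqrt hL.le, Real.sq_sqrt hn'.le]
              field_simp
              norm_num
      linarith
  have hsub : {ω | ¬ |(1 / (n : ℝ)) * (∑ t, ∑ k, V t ω (i, k) * V t ω (j, k)) /
      (A.trace * Real.sqrt (B i i * B j j)) - corr B i j| ≤ frobNorm A * τ / A.trace} ⊆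
      bad 1 ∪ bad (-1) := by
    intro ω hω
    by_contra hcon
    simp only [bad, Set.mem_union, Set.mem_ofPred_eq, not_or, not_le] at hcon
    apply hω
    obtain ⟨h1, h2⟩ := hcon
    rw [Finset.sum_sub_distrib, Finset.sum_const, Finset.card_univ, Fintype.card_fin,
      nsmul_eq_mul] at h1 h2
    set P := ∑ t, ∑ k, (∑ l, c 1 l * V t ω (l, k)) ^ 2 with hP
    set Q := ∑ t, ∑ k, (∑ l, c (-1) l * V t ω (l, k)) ^ 2 with hQ
    have hPQ : P - Q = 4 * (∑ t, ∑ k, V t ω (i, k) * V t ω (j, k)) / (p * q) := by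
      rw [hP, hQ, ← Finset.sum_sub_distrib, Finset.mul_sum, Finset.sum_div]
      refine Finset.sum_congr rfl fun t _ => ?_
      rw [← Finset.sum_sub_distrib, Finset.mul_sum, Finset.sum_div]
      refine Finset.sum_congr rfl fun k _ => ?_
      rw [hcx 1 fun l => V t ω (l, k), hcx (-1) fun l => V t ω (l, k)]
      field_simp
      ring
    set Z := ∑ t, ∑ k, V t ω (i, k) * V t ω (j, k) with hZ
    have heq : (1 / (n : ℝ)) * Z / (A.trace * Real.sqrt (B i i * B j j)) - corr B i j =
        ((P - n * ((c 1 ⬝ᵥ B *ᵥ c 1) * A.trace)) -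
          (Q - n * ((c (-1) ⬝ᵥ B *ᵥ c (-1)) * A.trace))) / (4 * n * A.trace) := by
      rw [sub_sub_sub_comm, hPQ, hvp, hvm, hpq]
      field_simp
      ring
    rw [heq, abs_div, abs_of_pos (show 0 < 4 * n * A.trace by positivity),
      div_le_div_iff₀ (by positivity) htr]
    have h3 := (abs_sub _ _).trans (add_le_add h1.le h2.le)
    calc _ ≤ (S + S) * A.trace := by gcongr
      _ = frobNorm A * τ * (4 * n * A.trace) := by rw [hS]; ring
  calc _ ≤ μ.real (bad 1) + μ.real (bad (-1)) :=
        (measureReal_mono hsub).trans (measureReal_union_le _ _)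
    _ ≤ 2 * Real.exp (-6 * L) + 2 * Real.exp (-6 * L) := by
        gcongr
        -- The two values of `v` are nonnegative with sum `4`, so each is at most `4`.
        · exact hbad 1 (by linarith)
        · exact hbad (-1) (by linarith)
    _ = 4 * Real.exp (-6 * L) := by ring

/-- Union bound over all pairs of rows. -/
lemma IsGaussianArraySample.measure_rows_le [DecidableEq ι] [DecidableEq κ] {n : ℕ}
    {V : Fin n → Ω → ι × κ → ℝ} {A : Matrix κ κ ℝ} {B : Matrix ι ι ℝ}
    (hV : IsGaussianArraySample V A B μ) (hA : A.PosDef) (hB : B.PosDef) [Nonempty κ]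
    (hn : 1 ≤ n) {N : ℕ} (hN : 2 ≤ N) (hι : Fintype.card ι ≤ N) {τ : ℝ}
    (hr : 4 * Real.log N / n ≤ stableRank A)
    (hτ : 28 * Real.sqrt (Real.log N) / Real.sqrt n ≤ τ) :
    μ.real {ω | ¬ ∀ i j, |(1 / (n : ℝ)) * (∑ t, ∑ k, V t ω (i, k) * V t ω (j, k)) /
      (A.trace * Real.sqrt (B i i * B j j)) - corr B i j| ≤ frobNorm A * τ / A.trace} ≤
      1 / (N : ℝ) ^ 2 := by
  have := hV.indep.isProbabilityMeasure
  have hN' : (2 : ℝ) ≤ N := by exact_mod_cast hN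
  have hL : 0 < Real.log N := Real.log_pos (by linarith)
  have hexp : Real.exp (-6 * Real.log N) = 1 / (N : ℝ) ^ 6 := by
    rw [neg_mul, Real.exp_neg, mul_comm, Real.exp_mul, Real.exp_log (by linarith), one_div]
    norm_cast
  let E : ι × ι → Set Ω := fun x =>
    {ω | ¬ |(1 / (n : ℝ)) * (∑ t, ∑ k, V t ω (x.1, k) * V t ω (x.2, k)) /
      (A.trace * Real.sqrt (B x.1 x.1 * B x.2 x.2)) - corr B x.1 x.2| ≤
        frobNorm A * τ / A.trace}
  have hsub : {ω | ¬ ∀ i j, |(1 / (n : ℝ)) * (∑ t, ∑ k, V t ω (i, k) * V t ω (j, k)) /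
      (A.trace * Real.sqrt (B i i * B j j)) - corr B i j| ≤ frobNorm A * τ / A.trace} ⊆
      ⋃ x, E x := by
    intro ω hω
    simp only [Set.mem_ofPred_eq, not_forall] at hω
    obtain ⟨i, j, h⟩ := hω
    exact Set.mem_iUnion.2 ⟨(i, j), h⟩
  calc _ ≤ ∑ x, μ.real (E x) := (measureReal_mono hsub).trans (measureReal_iUnion_fintype_le _)
    _ ≤ ∑ _x : ι × ι, 4 * Real.exp (-6 * Real.log N) :=
        Finset.sum_le_sum fun x _ => hV.measure_rowPair_le hA hB hn hL hr hτ x.1 x.2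
    _ = (Fintype.card ι : ℝ) ^ 2 * (4 / (N : ℝ) ^ 6) := by
        rw [Finset.sum_const, Finset.card_univ, Fintype.card_prod, nsmul_eq_mul, hexp]
        push_cast
        ring
    _ ≤ (N : ℝ) ^ 2 * (4 / (N : ℝ) ^ 6) := by gcongr
    _ = 4 / (N : ℝ) ^ 2 * (1 / (N : ℝ) ^ 2) := by field_simp
    _ ≤ 1 * (1 / (N : ℝ) ^ 2) := by
        gcongr
        rw [div_le_one (by positivity)]
        nlinarith
    _ = _ := one_mul _

end Sample

end Gemini

/-! ### Rows and columns together -/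

theorem mainTheorem5 :
    ∃ C : ℝ, 0 < C ∧
      ∀ (n f m : ℕ), 1 ≤ n → 1 ≤ f → 1 ≤ m → 2 ≤ max m f →
      ∀ (A₀ : Matrix (Fin m) (Fin m) ℝ) (B₀ : Matrix (Fin f) (Fin f) ℝ),
        Gemini.SpectralAssumption n A₀ B₀ →
      ∀ (Ω : Type*) [MeasurableSpace Ω] (μ : Measure Ω) [IsProbabilityMeasure μ]
        (X : Fin n → Ω → Matrix (Fin f) (Fin m) ℝ),
        Gemini.IsMatrixNormalSample X A₀ B₀ μ →
        1 - 3 / ((max m f : ℕ) : ℝ) ^ 2 ≤ μ.real (Gemini.largeDeviationEvent C X A₀ B₀) := by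
  refine ⟨28, by norm_num, fun n f m hn hf hm hmf A B hAB Ω _ μ _ X hX => ?_⟩
  have : Nonempty (Fin m) := ⟨⟨0, hm⟩⟩
  have : Nonempty (Fin f) := ⟨⟨0, hf⟩⟩
  have hV := hX.isGaussianArraySample hAB.posDef_A.posSemidef hAB.posDef_B.posSemidef
  have hτ : 28 * Real.sqrt (Real.log (max m f : ℕ)) / Real.sqrt n ≤ Gemini.tau0 28 n f m := by
    rw [Gemini.tau0]
    gcongr
    -- `2 K² ≥ 1`, so `C = 28` supplies the constant required for each pair.
    linarith [Gemini.half_le_gaussianPsi2_sq]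
  have hrow := hV.measure_rows_le hAB.posDef_A hAB.posDef_B hn hmf (by simp) hAB.stableRank_A hτ
  have hcol := hV.swap.measure_rows_le hAB.posDef_B hAB.posDef_A hn hmf (by simp)
    hAB.stableRank_B hτ
  have hcompl : (Gemini.largeDeviationEvent 28 X A B)ᶜ ⊆ _ ∪ _ := fun ω hω =>
    not_and_or.1 hω
  have hbound := (measureReal_mono (μ := μ) hcompl).trans
    ((measureReal_union_le _ _).trans (add_le_add hrow hcol))
  have huniv : 1 ≤ μ.real (Gemini.largeDeviationEvent 28 X A B) +
      μ.real (Gemini.largeDeviationEvent 28 X A B)ᶜ := by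
    rw [← probReal_univ (μ := μ), ← Set.union_compl_self (Gemini.largeDeviationEvent 28 X A B)]
    exact measureReal_union_le _ _
  have h0 : 0 ≤ 1 / ((max m f : ℕ) : ℝ) ^ 2 := by positivity
  have h3 : 3 / ((max m f : ℕ) : ℝ) ^ 2 = 3 * (1 / ((max m f : ℕ) : ℝ) ^ 2) := by ring
  linarith
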